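/- Let $\gamma>1$, $l\ge 0$, $c_0>0$ be real constants and $L=\begin{pmatrix}0&-1\\1&0\end{pmatrix}$. Consider the frictionless system of seven real ODEs $$\dot R+RQ+Q^{T}R+(\gamma-1)\,\mathrm{tr}(Q)\,R=0,\qquad \dot Q+Q^2+l\,LQ+2c_0R=0,$$ $$R=\begin{pmatrix}A&\tfrac12B\\ \tfrac12B&C\end{pmatrix},\qquad Q=\begin{pmatrix}a&b\\c&d\end{pmatrix},$$ for $(A,B,C,a,b,c,d)$. Call a state a vortex if the eigenvalues of $Q$ are not real, i.e. $(\mathrm{tr}\,Q)^2<4\det Q$. (i) The equilibria that are vortices are exactly the points $$P_{b^*}:\quad a=d=0,\quad b=-c=b^*,\quad A=C=\frac{b^*(b^*-l)}{2c_0},\quad B=0,\qquad b^*\in\mathbb R\setminus\{0\};$$ so for each $b^*\neq0$ the point $P_{b^*}$ is the only vortex equilibrium with $b=b^*$. Moreover, every equilibrium of the system either is one of the points $P_{b^*}$, $b^*\in\mathbb R$, or satisfies $Q^2=0$ and $\det R=0$. (ii) If $b^*<\frac{1-\sqrt2}{2}\,l$ or $b^*>\frac{1+\sqrt2}{2}\,l$,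 then the linearization of the system at $P_{b^*}$ has an eigenvalue with positive real part, and the equilibrium $P_{b^*}$ is unstable in the sense of Lyapunov. -/

import Mathlib

namespace VortexODE

open scoped Matrix

/-- The state `(A, B, C, a, b, c, d)`: the coefficients of the quadratic pressure profile
`A x₁² + B x₁ x₂ + C x₂²` and of the linear velocity field with matrix `[a b; c d]`. -/
abbrev State := Fin 7 → ℝ

/-- The symmetric matrix `R = [A B/2; B/2 C]` of a state. -/
noncomputable def matR (x : State) : Matrix (Fin 2) (Fin 2) ℝ :=
  !![x 0, x 1 / 2; x 1 / 2, x 2]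

/-- The velocity matrix `Q = [a b; c d]` of a state. -/
def matQ (x : State) : Matrix (Fin 2) (Fin 2) ℝ :=
  !![x 3, x 4; x 5, x 6]

/-- The rotation matrix `L = [0 -1; 1 0]`. -/
def matL : Matrix (Fin 2) (Fin 2) ℝ :=
  !![0, -1; 1, 0]

/-- `Ṙ = -(RQ + QᵀR + (γ - 1) tr(Q) R)`. -/
noncomputable def rateR (γ : ℝ) (x : State) : Matrix (Fin 2) (Fin 2) ℝ :=
  -(matR x * matQ x + (matQ x)ᵀ * matR x + ((γ - 1) * (matQ x).trace) • matR x)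

/-- `Q̇ = -(Q² + l L Q + μ Q + 2 c₀ R)`. -/
noncomputable def rateQ (l μ c₀ : ℝ) (x : State) : Matrix (Fin 2) (Fin 2) ℝ :=
  -(matQ x ^ 2 + l • (matL * matQ x) + μ • matQ x + (2 * c₀) • matR x)

/-- The matrix system
`Ṙ + RQ + QᵀR + (γ - 1) tr(Q) R = 0`, `Q̇ + Q² + l L Q + μ Q + 2 c₀ R = 0`
as a vector field on the seven coefficients. -/
noncomputable def field (γ l μ c₀ : ℝ) (x : State) : State :=
  ![rateR γ x 0 0, 2 * rateR γ x 0 1, rateR γ x 1 1,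
    rateQ l μ c₀ x 0 0, rateQ l μ c₀ x 0 1, rateQ l μ c₀ x 1 0, rateQ l μ c₀ x 1 1]

/-- The vector field is the full matrix system: first equation. -/
theorem matR_field (γ l μ c₀ : ℝ) (x : State) :
    matR (field γ l μ c₀ x) = rateR γ x := by
  ext i j
  fin_cases i <;> fin_cases j <;>
    simp [matR, field, rateR, matQ, Matrix.mul_apply, Fin.sum_univ_two]
  ring

/-- The vector field is the full matrix system: second equation. -/
theorem matQ_field (γ l μ c₀ : ℝ) (x : State) :
    matQ (field γ l μ c₀ x) = rateQ l μ c₀ x := by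
  ext i j
  fin_cases i <;> fin_cases j <;> simp [matQ, field]

/-- The state `A = C = β (β - l) / (2 c₀)`, `B = 0`, `a = d = 0`, `b = -c = β`. -/
noncomputable def vortexState (l c₀ β : ℝ) : State :=
  ![β * (β - l) / (2 * c₀), 0, β * (β - l) / (2 * c₀), 0, β, -β, 0]

/-- The linear flow `ẋ = Q x` is rotating about the origin:
the eigenvalues of `Q` are not real. -/
def IsVortex (x : State) : Prop :=
  (matQ x).trace ^ 2 < 4 * (matQ x).det

section Dynamics

variable {E : Type*} [NormedAddCommGroup E] [NormedSpace ℝ E]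

/-- `p` is an equilibrium of `ẋ = F x`. -/
def IsEquilibrium (F : E → E) (p : E) : Prop := F p = 0

/-- `x` solves `ẋ = F x` on `[0, T]`. -/
def IsSolutionOn (F : E → E) (T : ℝ) (x : ℝ → E) : Prop :=
  ∀ t ∈ Set.Icc 0 T, HasDerivWithinAt x (F (x t)) (Set.Icc 0 T) t

/-- Lyapunov stability: solutions starting close to `p` stay close to `p` as long as
they exist. -/
def IsLyapunovStable (F : E → E) (p : E) : Prop :=
  ∀ ε > 0, ∃ δ > 0, ∀ T > 0, ∀ x : ℝ → E, IsSolutionOn F T x →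
    ‖x 0 - p‖ < δ → ∀ t ∈ Set.Icc 0 T, ‖x t - p‖ < ε

end Dynamics

/-- `z` is a complex eigenvalue of the real linear map `J`. -/
def HasComplexEigenvalue (J : State →L[ℝ] State) (z : ℂ) : Prop :=
  Module.End.HasEigenvalue
    (Matrix.toLin' ((LinearMap.toMatrix' (J : State →ₗ[ℝ] State)).map (fun r : ℝ => (r : ℂ)))) z

end VortexODE

/-! Split `R` and `Q` into isotropic, antisymmetric and traceless symmetric parts. At an equilibrium
this forces `tr Q = 0`, and then either the traceless parts vanish, which is a uniform rotation, or
`Q² = 0` and `det R = 0` (`IsEquilibrium.eq_vortexState_or`).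

At a uniform rotation the linearization splits. The traceless parts obey, up to a rotation of rate
`β + l / 2`, the system `ṁ = -g`, `ġ = -D m` with `D = β² - βl - l²/4`; this gives an eigenvalue
with real part `√D > 0`. The rest is `ṗ = -e`, `ė = -κ p`, `ṡ = τ p`.

Instability does not use spectral theory: a quadratic form `B`, positive somewhere, is built block
by block with `Ḃ > 2νB`, and Chetaev's argument carries it to the nonlinear flow
(`not_isLyapunovStable_of_quadraticForm`). -/

namespace VortexODE

/-! ### Chetaev's instability criterion. -/

section Instability

open Set Metric Filter Topology

variable {E : Type*} [NormedAddCommGroup E] [NormedSpace ℝ E]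

/-- A bounded globally Lipschitz vector field has solutions on every interval `[0, T]`. -/
theorem exists_isSolutionOn_of_lipschitz_of_bounded [CompleteSpace E] {F : E → E}
    {K : NNReal} (hF : LipschitzWith K F) {C : ℝ} (hC : ∀ x, ‖F x‖ ≤ C) (x₀ : E)
    {T : ℝ} (hT : 0 ≤ T) : ∃ x : ℝ → E, x 0 = x₀ ∧ IsSolutionOn F T x := by
  have hC0 : 0 ≤ C := (norm_nonneg _).trans (hC 0)
  have h : IsPicardLindelof (fun _ : ℝ ↦ F) (⟨0, left_mem_Icc.2 hT⟩ : Icc (0 : ℝ) T) x₀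
      (⟨C, hC0⟩ * ⟨T, hT⟩) 0 ⟨C, hC0⟩ K := by
    refine IsPicardLindelof.of_time_independent (fun x _ ↦ hC x) (hF.lipschitzOnWith) ?_
    simp only [sub_zero, sub_self, max_eq_left hT, NNReal.coe_zero]
    exact le_rfl
  obtain ⟨x, hx0, hx⟩ := h.exists_eq_forall_mem_Icc_hasDerivWithinAt₀
  exact ⟨x, hx0, hx⟩

/-- A continuous curve starting in the open ball that meets its complement meets it for a first
time. -/
theorem exists_first_exit {X : Type*} [SeminormedAddCommGroup X] {x : ℝ → X} {T r : ℝ} {p : X}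
    (hx : ContinuousOn x (Icc 0 T))
    {t : ℝ} (ht : t ∈ Icc 0 T) (hxt : r ≤ ‖x t - p‖) :
    ∃ τ ∈ Icc 0 T, r ≤ ‖x τ - p‖ ∧ ∀ s ∈ Ico 0 τ, ‖x s - p‖ < r := by
  have hcomp : IsCompact (Icc 0 T ∩ (fun t ↦ ‖x t - p‖) ⁻¹' Ici r) :=
    isCompact_Icc.of_isClosed_subset
      ((hx.sub continuousOn_const).norm.preimage_isClosed_of_isClosed isClosed_Icc isClosed_Ici)
      inter_subset_left
  obtain ⟨τ, ⟨hτ, hτr⟩, hmin⟩ := hcomp.exists_isLeast ⟨t, ht, hxt⟩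
  refine ⟨τ, hτ, hτr, fun s hs ↦ ?_⟩
  by_contra! h
  exact absurd (hmin ⟨⟨hs.1, hs.2.le.trans hτ.2⟩, h⟩) (not_le.2 hs.2)

theorem IsSolutionOn.continuousOn {F : E → E} {T : ℝ} {x : ℝ → E} (hx : IsSolutionOn F T x) :
    ContinuousOn x (Icc 0 T) := fun t ht ↦ (hx t ht).continuousWithinAt

theorem IsSolutionOn.congr_mono {F G : E → E} {S T : ℝ} {x : ℝ → E} (hx : IsSolutionOn F T x)
    (hST : S ≤ T) (h : ∀ t ∈ Icc 0 S, F (x t) = G (x t)) : IsSolutionOn G S x := fun t ht ↦ by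
  rw [← h t ht]
  exact (hx t ⟨ht.1, ht.2.trans hST⟩).mono (Icc_subset_Icc_right hST)

/-- Near a Lyapunov stable point of a `C¹` vector field, solutions exist for all times and remain
close to the point. -/
theorem IsLyapunovStable.exists_isSolutionOn [FiniteDimensional ℝ E] {F : E → E} {p : E}
    (hF : ContDiff ℝ 1 F) (hs : IsLyapunovStable F p) {r : ℝ} (hr : 0 < r) :
    ∃ δ > 0, ∀ x₀, ‖x₀ - p‖ < δ → ∀ T > 0, ∃ x : ℝ → E, x 0 = x₀ ∧ IsSolutionOn F T x ∧
      ∀ t ∈ Icc 0 T, ‖x t - p‖ < r := by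
  obtain ⟨δ, hδ, hstab⟩ := hs r hr
  refine ⟨min δ r, lt_min hδ hr, fun x₀ hx₀ T hT ↦ ?_⟩
  -- Stability says nothing if solutions fail to exist, so existence must be proved. The cut-off
  -- field is bounded and globally Lipschitz; its solution also solves `F` until the first exit from
  -- the ball, which stability rules out.
  let φ : ContDiffBump p := ⟨r, 2 * r, hr, by linarith⟩
  let G : E → E := fun x ↦ φ x • F x
  have hG : ContDiff ℝ 1 G := φ.contDiff.smul hF
  have hGc : HasCompactSupport G := φ.hasCompactSupport.smul_right
  have hGF : ∀ x, ‖x - p‖ ≤ r → G x = F x := fun x hx ↦ by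
    simp only [G, φ.one_of_mem_closedBall (mem_closedBall_iff_norm.2 hx), one_smul]
  obtain ⟨K, hK⟩ := hG.lipschitzWith_of_hasCompactSupport hGc one_ne_zero
  obtain ⟨C, hC⟩ := hGc.exists_bound_of_continuous hG.continuous
  have : CompleteSpace E := FiniteDimensional.complete ℝ E
  obtain ⟨x, hx0, hx⟩ := exists_isSolutionOn_of_lipschitz_of_bounded hK hC x₀ hT.le
  have hstay : ∀ t ∈ Icc 0 T, ‖x t - p‖ < r := by
    intro t ht
    by_contra! hxt
    obtain ⟨τ, hτ, hτr, hlt⟩ := exists_first_exit hx.continuousOn ht hxt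
    have hτ0 : 0 < τ := by
      refine hτ.1.lt_of_ne fun h ↦ ?_
      rw [← h, hx0] at hτr
      exact absurd (hx₀.trans_le (min_le_right _ _)) (not_lt.2 hτr)
    have hle : ∀ s ∈ Icc 0 τ, ‖x s - p‖ ≤ r := by
      have hcl : closure (Ico 0 τ) = Icc 0 τ := closure_Ico hτ0.ne
      rw [← hcl]
      refine fun s hs ↦ ContinuousWithinAt.closure_le hs ?_ continuousWithinAt_const
        fun u hu ↦ (hlt u hu).le
      rw [hcl] at hs
      exact (((hx.continuousOn.sub continuousOn_const).norm) s ⟨hs.1, hs.2.trans hτ.2⟩).mono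
        (Ico_subset_Icc_self.trans (Icc_subset_Icc_right hτ.2))
    have hsol : IsSolutionOn F τ x := hx.congr_mono hτ.2 fun s hs ↦ hGF _ (hle s hs)
    exact absurd (hstab τ hτ0 x hsol (by rw [hx0]; exact hx₀.trans_le (min_le_left _ _)) τ
      (right_mem_Icc.2 hτ0.le)) (not_lt.2 hτr)
  exact ⟨x, hx0, hx.congr_mono le_rfl fun t ht ↦ hGF _ (hstay t ht).le, hstay⟩

/-- Chetaev's criterion with exponential growth: if `V` grows at least like `exp (ν t)` along
solutions near `p` and takes positive values arbitrarily close to `p`, then `p` is unstable. -/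
theorem not_isLyapunovStable_of_chetaev [FiniteDimensional ℝ E] {F : E → E} {p : E}
    (hF : ContDiff ℝ 1 F) {V : E → ℝ} {V' : E → E →L[ℝ] ℝ} (hV : ∀ x, HasFDerivAt V (V' x) x)
    {ν : ℝ} (hν : 0 < ν) (hgrow : ∀ᶠ x in 𝓝 p, ν * V x ≤ V' x (F x))
    (hpos : ∃ᶠ x in 𝓝 p, 0 < V x) : ¬ IsLyapunovStable F p := by
  intro hs
  have hVb : ∀ᶠ x in 𝓝 p, V x < V p + 1 :=
    (hV p).continuousAt.eventually_lt continuousAt_const (by linarith)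
  obtain ⟨r, hr, hball⟩ := Metric.eventually_nhds_iff.1 (hgrow.and hVb)
  obtain ⟨δ, hδ, hex⟩ := hs.exists_isSolutionOn hF hr
  obtain ⟨x₀, hx₀, hx₀δ⟩ := (hpos.and_eventually (ball_mem_nhds p hδ)).exists
  -- `V` is below `V p + 1` on the ball, so growth past that value by time `T` is the contradiction.
  have hlim : Tendsto (fun T ↦ V x₀ * Real.exp (ν * T)) atTop atTop :=
    ((Real.tendsto_exp_atTop.comp (tendsto_id.const_mul_atTop hν))).const_mul_atTop hx₀
  obtain ⟨T, hTV, hT⟩ := ((hlim.eventually_ge_atTop (V p + 1)).and (eventually_gt_atTop 0)).exists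
  obtain ⟨x, hx0, hx, hxr⟩ := hex x₀ (mem_ball_iff_norm.1 hx₀δ) T hT
  have hxball : ∀ t ∈ Icc 0 T, dist (x t) p < r := fun t ht ↦ by
    rw [dist_eq_norm]; exact hxr t ht
  have hderiv : ∀ t ∈ Icc 0 T, HasDerivWithinAt (fun t ↦ V (x t) * Real.exp (-ν * t))
      (V' (x t) (F (x t)) * Real.exp (-ν * t) + V (x t) * (Real.exp (-ν * t) * (-ν)))
      (Icc 0 T) t := fun t ht ↦ by
    have h1 := (hV (x t)).comp_hasDerivWithinAt t (hx t ht)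
    have h2 : HasDerivAt (fun t ↦ Real.exp (-ν * t)) (Real.exp (-ν * t) * (-ν)) t := by
      simpa using ((hasDerivAt_id t).const_mul (-ν)).exp
    exact h1.mul h2.hasDerivWithinAt
  have hmono : MonotoneOn (fun t ↦ V (x t) * Real.exp (-ν * t)) (Icc 0 T) := by
    refine monotoneOn_of_hasDerivWithinAt_nonneg (convex_Icc 0 T)
      (fun t ht ↦ (hderiv t ht).continuousWithinAt)
      (fun t ht ↦ (hderiv t (interior_subset ht)).mono interior_subset) fun t ht ↦ ?_
    have := (hball (hxball t (interior_subset ht))).1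
    have hexp := Real.exp_pos (-ν * t)
    nlinarith
  have hend := hmono (left_mem_Icc.2 hT.le) (right_mem_Icc.2 hT.le) hT.le
  simp only [hx0, mul_zero, Real.exp_zero, mul_one] at hend
  have hVT := (hball (hxball T (right_mem_Icc.2 hT.le))).2
  have hle : V x₀ * Real.exp (ν * T) ≤ V (x T) := by
    calc V x₀ * Real.exp (ν * T) ≤ V (x T) * Real.exp (-ν * T) * Real.exp (ν * T) := by gcongr
      _ = V (x T) := by rw [mul_assoc, ← Real.exp_add]; simp
  linarith

/-- A positive definite continuous quadratic form is bounded below by a multiple of the squared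
norm. -/
theorem exists_forall_mul_norm_sq_le [FiniteDimensional ℝ E] {W : E → ℝ} (hW : Continuous W)
    (hsmul : ∀ (c : ℝ) y, W (c • y) = c ^ 2 * W y) (hpos : ∀ y ≠ 0, 0 < W y) :
    ∃ c > 0, ∀ y, c * ‖y‖ ^ 2 ≤ W y := by
  have h0 : W 0 = 0 := by simpa using hsmul 0 0
  rcases (sphere (0 : E) 1).eq_empty_or_nonempty with he | hne
  · refine ⟨1, one_pos, fun y ↦ ?_⟩
    by_cases hy : y = 0
    · simp [hy, h0]
    · have : (‖y‖⁻¹ • y) ∈ sphere (0 : E) 1 := by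
        simp [norm_smul, norm_ne_zero_iff.2 hy]
      simp [he] at this
  · obtain ⟨z, hz, hmin⟩ := (isCompact_sphere (0 : E) 1).exists_isMinOn hne hW.continuousOn
    have hz0 : z ≠ 0 := ne_zero_of_mem_unit_sphere ⟨z, hz⟩
    refine ⟨W z, hpos z hz0, fun y ↦ ?_⟩
    by_cases hy : y = 0
    · simp [hy, h0]
    · have hn : ‖y‖ ≠ 0 := norm_ne_zero_iff.2 hy
      have hmem : (‖y‖⁻¹ • y) ∈ sphere (0 : E) 1 := by simp [norm_smul, hn]
      have h1 : W z ≤ W (‖y‖⁻¹ • y) := hmin hmem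
      have h2 : W y = W (‖y‖⁻¹ • y) * ‖y‖ ^ 2 := by
        rw [hsmul]; field_simp
      rw [h2]
      gcongr

/-- Instability from the linearization: if along the linearized flow a quadratic form `B y y`
taking a positive value satisfies `d/dt B y y > ν * B y y` for some `ν > 0`, then the equilibrium
is unstable. -/
theorem not_isLyapunovStable_of_quadraticForm [FiniteDimensional ℝ E] {F : E → E} {p : E}
    (hF : ContDiff ℝ 1 F) (hp : IsEquilibrium F p) {J : E →L[ℝ] E} (hJ : HasFDerivAt F J p)
    (B : E →L[ℝ] E →L[ℝ] ℝ) {ν : ℝ} (hν : 0 < ν)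
    (hB : ∀ y ≠ 0, ν * B y y < B (J y) y + B y (J y)) {v : E} (hv : 0 < B v v) :
    ¬ IsLyapunovStable F p := by
  obtain ⟨c, hc, hcW⟩ := exists_forall_mul_norm_sq_le
    (W := fun y ↦ B (J y) y + B y (J y) - ν * B y y) (by fun_prop)
    (fun c y ↦ by simp only [map_smul, smul_apply, smul_eq_mul]; ring)
    (fun y hy ↦ by linarith [hB y hy])
  have hV : ∀ x, HasFDerivAt (fun x ↦ B (x - p) (x - p)) (B (x - p) + B.flip (x - p)) x := by
    intro x
    have hid : HasFDerivAt (fun x ↦ x - p) (ContinuousLinearMap.id ℝ E) x :=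
      (hasFDerivAt_id x).sub_const p
    have := B.hasFDerivAt_of_bilinear hid hid
    refine this.congr_fderiv ?_
    ext y
    simp [ContinuousLinearMap.precompR, ContinuousLinearMap.precompL]
  refine not_isLyapunovStable_of_chetaev hF hV hν ?_ ?_
  -- With this tolerance the two remainder terms `B y w` and `B w y` cost at most `c * ‖y‖ ^ 2`,
  -- exactly the gain from `hcW`; the `+ 1` keeps the denominator positive when `B = 0`.
  · have hlo := hJ.isLittleO.def (c := c / (2 * ‖B‖ + 1)) (by positivity)
    filter_upwards [hlo] with x hx
    rw [show F p = 0 from hp, sub_zero] at hx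
    set y := x - p with hy
    set w := F x - J y with hw
    have hFx : F x = J y + w := by rw [hw]; abel
    have h1 : |B y w| ≤ ‖B‖ * ‖y‖ * ‖w‖ := B.le_opNorm₂ y w
    have h2 : |B w y| ≤ ‖B‖ * ‖w‖ * ‖y‖ := B.le_opNorm₂ w y
    have h3 : 2 * ‖B‖ * ‖y‖ * ‖w‖ ≤ c * ‖y‖ ^ 2 := by
      calc 2 * ‖B‖ * ‖y‖ * ‖w‖ ≤ 2 * ‖B‖ * ‖y‖ * (c / (2 * ‖B‖ + 1) * ‖y‖) := by gcongr
        _ = (2 * ‖B‖) / (2 * ‖B‖ + 1) * (c * ‖y‖ ^ 2) := by ring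
        _ ≤ 1 * (c * ‖y‖ ^ 2) := by
          gcongr
          exact (div_le_one (by positivity)).2 (by linarith)
        _ = c * ‖y‖ ^ 2 := one_mul _
    have h4 := hcW y
    rw [hFx]
    simp only [add_apply, ContinuousLinearMap.flip_apply, map_add]
    have h5 := neg_abs_le (B y w)
    have h6 := neg_abs_le (B w y)
    nlinarith
  · have hcurve : Tendsto (fun t : ℝ ↦ p + t • v) (𝓝[>] 0) (𝓝 p) := by
      have : ContinuousAt (fun t : ℝ ↦ p + t • v) 0 := by fun_prop
      have h := this.tendsto
      simp only [zero_smul, add_zero] at h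
      exact h.mono_left nhdsWithin_le_nhds
    refine hcurve.frequently (Eventually.frequently ?_)
    filter_upwards [self_mem_nhdsWithin] with t ht
    have ht : 0 < t := ht
    simp only [add_sub_cancel_left, map_smul, smul_apply, smul_eq_mul]
    positivity

end Instability

end VortexODE

/-! ### Classification of equilibria. -/

namespace VortexODE

open scoped Matrix

theorem field_apply (γ l μ c₀ : ℝ) (x : State) : field γ l μ c₀ x =
    ![-(2 * x 0 * x 3 + x 1 * x 5 + (γ - 1) * (x 3 + x 6) * x 0),
      -(2 * x 0 * x 4 + x 1 * x 6 + x 3 * x 1 + 2 * x 5 * x 2 + (γ - 1) * (x 3 + x 6) * x 1),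
      -(x 1 * x 4 + 2 * x 2 * x 6 + (γ - 1) * (x 3 + x 6) * x 2),
      -(x 3 ^ 2 + x 4 * x 5 - l * x 5 + μ * x 3 + 2 * c₀ * x 0),
      -(x 3 * x 4 + x 4 * x 6 - l * x 6 + μ * x 4 + c₀ * x 1),
      -(x 5 * x 3 + x 6 * x 5 + l * x 3 + μ * x 5 + c₀ * x 1),
      -(x 5 * x 4 + x 6 ^ 2 + l * x 4 + μ * x 6 + 2 * c₀ * x 2)] := by
  ext i
  fin_cases i <;>
    simp [field, rateR, rateQ, matR, matQ, matL, pow_two, Matrix.mul_apply, Fin.sum_univ_two,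
      Matrix.trace] <;> ring

theorem contDiff_field (γ l μ c₀ : ℝ) : ContDiff ℝ 1 (field γ l μ c₀) := by
  rw [contDiff_pi]
  intro i
  simp only [field_apply]
  fin_cases i <;> simp <;> fun_prop

theorem isEquilibrium_vortexState (γ l β : ℝ) {c₀ : ℝ} (hc₀ : c₀ ≠ 0) :
    IsEquilibrium (field γ l 0 c₀) (vortexState l c₀ β) := by
  rw [IsEquilibrium, field_apply]
  ext i
  fin_cases i <;> simp [vortexState] <;> field_simp <;> ring

theorem isVortex_vortexState (l c₀ : ℝ) {β : ℝ} (hβ : β ≠ 0) :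
    IsVortex (vortexState l c₀ β) := by
  have : 0 < β ^ 2 := by positivity
  simp only [IsVortex, matQ, vortexState, Matrix.trace_fin_two, Matrix.det_fin_two]
  simp
  nlinarith

/-- An equilibrium is a uniform rotation, or both of its matrices are degenerate. -/
theorem IsEquilibrium.eq_vortexState_or {γ l c₀ : ℝ} (hγ : 0 < γ) (hc₀ : 0 < c₀) {x : State}
    (hx : IsEquilibrium (field γ l 0 c₀) x) :
    (∃ β : ℝ, x = vortexState l c₀ β) ∨ (matQ x ^ 2 = 0 ∧ (matR x).det = 0) := by
  rw [IsEquilibrium, field_apply] at hx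
  have h0 := congrFun hx 0
  have h1 := congrFun hx 1
  have h2 := congrFun hx 2
  have h3 := congrFun hx 3
  have h4 := congrFun hx 4
  have h5 := congrFun hx 5
  have h6 := congrFun hx 6
  simp at h0 h1 h2 h3 h4 h5 h6
  -- `R = ρ + n` and `Q = p + s L + m`, with `n` and `m` traceless symmetric.
  obtain ⟨ρ, hρ⟩ : ∃ ρ, ρ = (x 0 + x 2) / 2 := ⟨_, rfl⟩
  obtain ⟨n₁, hn₁⟩ : ∃ n, n = (x 0 - x 2) / 2 := ⟨_, rfl⟩
  obtain ⟨n₂, hn₂⟩ : ∃ n, n = x 1 / 2 := ⟨_, rfl⟩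
  obtain ⟨p, hp⟩ : ∃ p, p = (x 3 + x 6) / 2 := ⟨_, rfl⟩
  obtain ⟨s, hs⟩ : ∃ s, s = (x 5 - x 4) / 2 := ⟨_, rfl⟩
  obtain ⟨m₁, hm₁⟩ : ∃ m, m = (x 3 - x 6) / 2 := ⟨_, rfl⟩
  obtain ⟨m₂, hm₂⟩ : ∃ m, m = (x 4 + x 5) / 2 := ⟨_, rfl⟩
  have e0 : x 0 = ρ + n₁ := by linarith
  have e1 : x 1 = 2 * n₂ := by linarith
  have e2 : x 2 = ρ - n₁ := by linarith
  have e3 : x 3 = p + m₁ := by linarith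
  have e4 : x 4 = m₂ - s := by linarith
  have e5 : x 5 = m₂ + s := by linarith
  have e6 : x 6 = p - m₁ := by linarith
  clear hρ hn₁ hn₂ hp hs hm₁ hm₂
  rw [e0, e1, e3, e5, e6] at h0
  rw [e0, e1, e2, e3, e4, e5, e6] at h1
  rw [e1, e2, e3, e4, e6] at h2
  rw [e0, e3, e4, e5] at h3
  rw [e1, e3, e4, e6] at h4
  rw [e1, e3, e5, e6] at h5
  rw [e2, e4, e5, e6] at h6
  have k1 : γ * p * ρ + n₁ * m₁ + n₂ * m₂ = 0 := by linarith
  have k2 : ρ * m₁ + γ * p * n₁ + s * n₂ = 0 := by linarith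
  have k3 : ρ * m₂ + γ * p * n₂ - s * n₁ = 0 := by linarith
  have k4 : p ^ 2 - s ^ 2 + m₁ ^ 2 + m₂ ^ 2 - l * s + 2 * c₀ * ρ = 0 := by linarith
  have k5 : p * (2 * s + l) = 0 := by linarith
  have k6 : 2 * p * m₁ - l * m₂ + 2 * c₀ * n₁ = 0 := by linarith
  have k7 : 2 * p * m₂ + l * m₁ + 2 * c₀ * n₂ = 0 := by linarith
  -- Otherwise `s = -l / 2`, and `k4` becomes a sum of nonnegative terms containing `p ^ 2 > 0`,
  -- once `ρ ≥ 0` is known.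
  have hp : p = 0 := by
    rcases mul_eq_zero.1 k5 with hp | hs
    · exact hp
    by_contra hp
    have hm : m₁ ^ 2 + m₂ ^ 2 = c₀ * γ * ρ := mul_left_cancel₀ hp (by
      linear_combination (m₁ / 2) * k6 + (m₂ / 2) * k7 - c₀ * k1)
    have hρ : 0 ≤ ρ := by
      have : 0 ≤ (c₀ * γ) * ρ := by rw [← hm]; positivity
      exact nonneg_of_mul_nonneg_right this (by positivity)
    have : 0 < p ^ 2 := by positivity
    have := mul_nonneg hc₀.le hρ
    have hs' : s = -l / 2 := by linarith
    rw [hs'] at k4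
    nlinarith [sq_nonneg l, sq_nonneg m₁, sq_nonneg m₂]
  subst hp
  have hn1 : n₁ = l * m₂ / (2 * c₀) := by field_simp; linarith
  have hn2 : n₂ = -(l * m₁) / (2 * c₀) := by field_simp; linarith
  have j1 : m₁ * (2 * c₀ * ρ - l * s) = 0 := by
    rw [hn2] at k2; field_simp at k2; linarith
  have j2 : m₂ * (2 * c₀ * ρ - l * s) = 0 := by
    rw [hn1] at k3; field_simp at k3; linarith
  by_cases hm : m₁ = 0 ∧ m₂ = 0
  · obtain ⟨rfl, rfl⟩ := hm
    left
    have hρ : ρ = -s * (-s - l) / (2 * c₀) := by field_simp; linarith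
    refine ⟨-s, ?_⟩
    ext i
    fin_cases i <;> simp [vortexState, e0, e1, e2, e3, e4, e5, e6, hn1, hn2, hρ]
  · right
    have hρ : 2 * c₀ * ρ - l * s = 0 := by
      by_contra h
      exact hm ⟨(mul_eq_zero.1 j1).resolve_right h, (mul_eq_zero.1 j2).resolve_right h⟩
    have hρ' : ρ = l * s / (2 * c₀) := by field_simp; linarith
    -- Both determinants are multiples of `s² - |m|²`.
    have hms : m₁ ^ 2 + m₂ ^ 2 = s ^ 2 := by linarith
    constructor
    · ext i j
      fin_cases i <;> fin_cases j <;>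
        simp [matQ, pow_two, Matrix.mul_apply, Fin.sum_univ_two, e3, e4, e5, e6] <;>
        linarith
    · simp only [matR, Matrix.det_fin_two_of, e0, e1, e2, hn1, hn2, hρ']
      field_simp
      linear_combination -l ^ 2 * hms

theorem not_isVortex_of_sq_eq_zero {x : State} (hx : matQ x ^ 2 = 0) : ¬ IsVortex x := by
  have hdet : (matQ x).det = 0 := by
    have := congrArg Matrix.det hx
    rw [Matrix.det_pow, Matrix.det_zero] at this
    exact pow_eq_zero_iff two_ne_zero |>.1 this
  rw [IsVortex, hdet]
  nlinarith [sq_nonneg (matQ x).trace]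

theorem isEquilibrium_and_isVortex_iff {γ l c₀ : ℝ} (hγ : 0 < γ) (hc₀ : 0 < c₀) (x : State) :
    (IsEquilibrium (field γ l 0 c₀) x ∧ IsVortex x) ↔
      ∃ β : ℝ, β ≠ 0 ∧ x = vortexState l c₀ β := by
  constructor
  · rintro ⟨hx, hv⟩
    rcases hx.eq_vortexState_or hγ hc₀ with ⟨β, rfl⟩ | ⟨hQ, -⟩
    · refine ⟨β, ?_, rfl⟩
      rintro rfl
      simp [IsVortex, matQ, vortexState, Matrix.trace_fin_two, Matrix.det_fin_two] at hv
    · exact absurd hv (not_isVortex_of_sq_eq_zero hQ)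
  · rintro ⟨β, hβ, rfl⟩
    exact ⟨isEquilibrium_vortexState γ l β hc₀.ne', isVortex_vortexState l c₀ hβ⟩

/-! ### Linearization at a uniform rotation. -/

/-- The Jacobian of the frictionless field at the state with `A = C = K`, `B = 0`, `a = d = 0`,
`b = -c = β`. -/
def jacobian (γ l c₀ β K : ℝ) : Matrix (Fin 7) (Fin 7) ℝ :=
  !![0, β, 0, -((γ + 1) * K), 0, 0, -((γ - 1) * K);
     -(2 * β), 0, 2 * β, 0, -(2 * K), -(2 * K), 0;
     0, -β, 0, -((γ - 1) * K), 0, 0, -((γ + 1) * K);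
     -(2 * c₀), 0, 0, 0, β, l - β, 0;
     0, -c₀, 0, -β, 0, 0, l - β;
     0, -c₀, 0, β - l, 0, 0, β;
     0, 0, -(2 * c₀), 0, β - l, -β, 0]

theorem jacobian_mulVec (γ l c₀ β K : ℝ) (y : State) : jacobian γ l c₀ β K *ᵥ y =
    ![β * y 1 - (γ + 1) * K * y 3 - (γ - 1) * K * y 6,
      -(2 * β * y 0) + 2 * β * y 2 - 2 * K * y 4 - 2 * K * y 5,
      -(β * y 1) - (γ - 1) * K * y 3 - (γ + 1) * K * y 6,
      -(2 * c₀ * y 0) + β * y 4 + (l - β) * y 5,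
      -(c₀ * y 1) - β * y 3 + (l - β) * y 6,
      -(c₀ * y 1) + (β - l) * y 3 + β * y 6,
      -(2 * c₀ * y 2) + (β - l) * y 4 - β * y 5] := by
  ext i
  fin_cases i <;> simp [jacobian, Matrix.mulVec, dotProduct, Fin.sum_univ_succ] <;> ring

theorem hasFDerivAt_field_vortexState (γ l c₀ β : ℝ) :
    HasFDerivAt (field γ l 0 c₀)
      (Matrix.toLin' (jacobian γ l c₀ β (β * (β - l) / (2 * c₀)))).toContinuousLinearMap
      (vortexState l c₀ β) := by
  have hd := ((contDiff_field γ l 0 c₀).differentiable one_ne_zero (vortexState l c₀ β)).hasFDerivAt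
  refine hd.congr_fderiv (ContinuousLinearMap.ext fun y ↦ Eq.symm ?_)
  have hline : HasDerivAt (fun t : ℝ ↦ field γ l 0 c₀ (vortexState l c₀ β + t • y))
      (fderiv ℝ (field γ l 0 c₀) (vortexState l c₀ β) y) 0 :=
    hd.hasLineDerivAt y
  refine HasDerivAt.unique (hasDerivAt_pi.2 fun i ↦ ?_) hline
  have key : ∃ N : ℝ, (fun t : ℝ ↦ field γ l 0 c₀ (vortexState l c₀ β + t • y) i) =
      fun t ↦ field γ l 0 c₀ (vortexState l c₀ β) i +
        t * (jacobian γ l c₀ β (β * (β - l) / (2 * c₀)) *ᵥ y) i + t ^ 2 * N := by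
    -- Setting `l = μ = c₀ = 0` leaves the homogeneous quadratic part of the field, which is the
    -- whole second-order remainder.
    refine ⟨field γ 0 0 0 y i, funext fun t ↦ ?_⟩
    rw [jacobian_mulVec]
    simp only [field_apply]
    generalize hK : β * (β - l) / (2 * c₀) = K
    fin_cases i <;> simp [vortexState, hK] <;> ring
  obtain ⟨N, hN⟩ := key
  rw [hN]
  have := (((hasDerivAt_id (0 : ℝ)).mul_const
    ((jacobian γ l c₀ β (β * (β - l) / (2 * c₀)) *ᵥ y) i)).const_add
      (field γ l 0 c₀ (vortexState l c₀ β) i)).add (((hasDerivAt_id (0 : ℝ)).pow 2).mul_const N)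
  simpa [Pi.add_def] using this

/-- The discriminant of the elliptic block of the linearization is positive outside of the
interval between its roots. -/
theorem discr_pos {l β : ℝ} (hl : 0 ≤ l)
    (hβ : β < (1 - √2) / 2 * l ∨ (1 + √2) / 2 * l < β) : 0 < β ^ 2 - β * l - l ^ 2 / 4 := by
  have h2 : √2 ^ 2 = 2 := Real.sq_sqrt (by norm_num)
  have hfac : β ^ 2 - β * l - l ^ 2 / 4 =
      ((1 - √2) / 2 * l - β) * ((1 + √2) / 2 * l - β) := by
    linear_combination (l ^ 2 / 4) * h2
  have hord : 0 ≤ √2 * l := by positivity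
  rw [hfac]
  rcases hβ with h | h
  · exact mul_pos (by linarith) (by linarith)
  · exact mul_pos_of_neg_of_neg (by linarith) (by linarith)

theorem exists_hasComplexEigenvalue_jacobian (γ l β : ℝ) {c₀ : ℝ} (hc₀ : c₀ ≠ 0)
    (hD : 0 < β ^ 2 - β * l - l ^ 2 / 4) :
    ∃ z : ℂ, 0 < z.re ∧ HasComplexEigenvalue
      (Matrix.toLin' (jacobian γ l c₀ β (β * (β - l) / (2 * c₀)))).toContinuousLinearMap z := by
  have hσ : ((√(β ^ 2 - β * l - l ^ 2 / 4) : ℝ) : ℂ) ^ 2 = β ^ 2 - β * l - l ^ 2 / 4 := by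
    exact_mod_cast congrArg (fun r : ℝ ↦ (r : ℂ)) (Real.sq_sqrt hD.le)
  have hσ0 := Real.sqrt_pos.2 hD
  generalize √(β ^ 2 - β * l - l ^ 2 / 4) = σ at hσ hσ0
  obtain ⟨z, hz⟩ : ∃ z : ℂ, z = σ - Complex.I * (β + l / 2) := ⟨_, rfl⟩
  have hzz : z ^ 2 + Complex.I * (2 * β + l) * z - 2 * β ^ 2 = 0 := by
    rw [hz]
    linear_combination hσ - (β + l / 2 : ℂ) ^ 2 * Complex.I_sq
  obtain ⟨K, hK⟩ : ∃ K, K = β * (β - l) / (2 * c₀) := ⟨_, rfl⟩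
  have hKc : (2 * c₀ * K : ℂ) = β * (β - l) := by
    have : 2 * c₀ * K = β * (β - l) := by rw [hK]; field_simp
    exact_mod_cast congrArg (fun r : ℝ ↦ (r : ℂ)) this
  have hc : (c₀ : ℂ) ≠ 0 := by exact_mod_cast hc₀
  refine ⟨z, by simp [hz, hσ0], ?_⟩
  rw [← hK, HasComplexEigenvalue, LinearMap.coe_toContinuousLinearMap, LinearMap.toMatrix'_toLin']
  -- This vector lies in the traceless block (`p = s = 0`, `A + C = 0`) with `m₂ = -i m₁`, on which
  -- the rotation acts as the scalar `-i (β + l / 2)`.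
  refine Module.End.hasEigenvalue_of_hasEigenvector
    (x := ![-(z + Complex.I * l), 2 * Complex.I * (z + Complex.I * l), z + Complex.I * l,
      2 * c₀, -(2 * Complex.I * c₀), -(2 * Complex.I * c₀), -(2 * c₀)]) ?_
  refine Module.End.hasEigenvector_iff.2 ⟨Module.End.mem_eigenspace_iff.2 ?_, fun h ↦ ?_⟩
  · have hI := Complex.I_sq
    rw [Matrix.toLin'_apply]
    ext i
    fin_cases i <;> simp [jacobian, Matrix.mulVec, dotProduct, Fin.sum_univ_succ]
    · linear_combination hzz - 2 * hKc + 2 * β * l * hI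
    · linear_combination -(2 * Complex.I) * hzz + 4 * Complex.I * hKc + 4 * β * z * hI
    · linear_combination -hzz + 2 * hKc - 2 * β * l * hI
    · ring
    · linear_combination -(2 * c₀ * l) * hI
    · linear_combination -(2 * c₀ * l) * hI
    · ring
  · simpa [hc] using congrFun h 3

/-! ### The growing quadratic form. -/

/-- The linear system `ṗ = -e`, `ė = -κ p` admits quadratic forms growing faster than
`exp (2 ν t)` whenever `ν` is positive and small. -/
theorem exists_growing_quadratic {κ ν : ℝ} (hν : 0 < ν) (hκ : 0 < κ → 4 * ν ^ 2 ≤ κ) :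
    ∃ α ξ ζ c : ℝ, 0 < c ∧ ∀ p e : ℝ, c * (p ^ 2 + e ^ 2) ≤
      -(2 * α * p * e) - 2 * ξ * κ * p * e - ζ * (e ^ 2 + κ * p ^ 2) -
        2 * ν * (α * p ^ 2 + ξ * e ^ 2 + ζ * p * e) := by
  by_cases h : 0 < κ
  -- Saddle: `-2pe` has derivative `2(e² + κp²)`.
  · refine ⟨0, 0, -2, min κ 1, lt_min h one_pos, fun p e ↦ ?_⟩
    have h1 : min κ 1 * p ^ 2 ≤ κ * p ^ 2 := by gcongr; exact min_le_left _ _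
    have h2 : min κ 1 * e ^ 2 ≤ 1 * e ^ 2 := by gcongr; exact min_le_right _ _
    have h3 : 4 * ν ^ 2 * p ^ 2 ≤ κ * p ^ 2 := by gcongr; exact hκ h
    nlinarith [sq_nonneg (e + 2 * ν * p)]
  -- The energy `e² - κp²` is conserved, so a negative definite form gains from the term `-2νV`;
  -- adding `ν²p²` keeps it definite at `κ = 0`.
  · refine ⟨-(ν ^ 2 - κ), -1, 0, ν * min (ν ^ 2) 1, by positivity, fun p e ↦ ?_⟩
    have h1 : ν * min (ν ^ 2) 1 * p ^ 2 ≤ ν * ν ^ 2 * p ^ 2 := by gcongr; exact min_le_left _ _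
    have h2 : ν * min (ν ^ 2) 1 * e ^ 2 ≤ ν * 1 * e ^ 2 := by gcongr; exact min_le_right _ _
    have h3 : 0 ≤ ν * (e + ν * p) ^ 2 := by positivity
    have h4 : 0 ≤ ν * (-κ) * p ^ 2 := by
      have := not_lt.1 h
      have : 0 ≤ -κ := by linarith
      positivity
    nlinarith

/-- Product of two linear functionals, as a bilinear form. -/
noncomputable def functionalMul (f g : State →L[ℝ] ℝ) : State →L[ℝ] State →L[ℝ] ℝ :=
  f.smulRight g

theorem functionalMul_apply (f g : State →L[ℝ] ℝ) (y z : State) :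
    functionalMul f g y z = f y * g z := by
  simp [functionalMul]

/-- This is the lower bound for `Ḃ - 2νB` in block coordinates. Half of `g² + Dm²` absorbs the term
`2νgm`, and the weight `τ²/ν` on `p²` absorbs the coupling of `s` to `p`. -/
theorem growth_pos_of_ne_zero {D ν τ m₁ m₂ g₁ g₂ p s e : ℝ} (hD : 0 < D) (hν : 0 < ν)
    (hνD : 4 * ν ^ 2 ≤ D)
    (hne : ¬ (m₁ = 0 ∧ m₂ = 0 ∧ g₁ = 0 ∧ g₂ = 0 ∧ p = 0 ∧ s = 0 ∧ e = 0)) :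
    0 < g₁ ^ 2 + D * m₁ ^ 2 + 2 * ν * g₁ * m₁ + (g₂ ^ 2 + D * m₂ ^ 2 + 2 * ν * g₂ * m₂) +
      (1 + τ ^ 2 / ν) * (p ^ 2 + e ^ 2) + 2 * ν * s ^ 2 - 2 * τ * p * s := by
  have hell : ∀ g m : ℝ, g ^ 2 / 2 + D * m ^ 2 / 2 ≤ g ^ 2 + D * m ^ 2 + 2 * ν * g * m := by
    intro g m
    have : 4 * ν ^ 2 * m ^ 2 ≤ D * m ^ 2 := by gcongr
    nlinarith [sq_nonneg (g + 2 * ν * m)]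
  have hcross : ν * s ^ 2 ≤ 2 * ν * s ^ 2 - 2 * τ * p * s + τ ^ 2 / ν * p ^ 2 := by
    have h1 : 0 ≤ (ν * s - τ * p) ^ 2 / ν := by positivity
    have h2 : (ν * s - τ * p) ^ 2 / ν = ν * s ^ 2 - 2 * τ * p * s + τ ^ 2 / ν * p ^ 2 := by
      field_simp
      ring
    linarith
  have he2 : 0 ≤ τ ^ 2 / ν * e ^ 2 := by positivity
  have hpos : 0 < g₁ ^ 2 / 2 + D * m₁ ^ 2 / 2 + (g₂ ^ 2 / 2 + D * m₂ ^ 2 / 2) + p ^ 2 + e ^ 2 +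
      ν * s ^ 2 := by
    simp only [not_and_or] at hne
    rcases hne with h | h | h | h | h | h | h <;> positivity
  linarith [hell g₁ m₁, hell g₂ m₂]

theorem not_isLyapunovStable_vortexState (γ l β : ℝ) {c₀ : ℝ} (hc₀ : c₀ ≠ 0)
    (hD : 0 < β ^ 2 - β * l - l ^ 2 / 4) :
    ¬ IsLyapunovStable (field γ l 0 c₀) (vortexState l c₀ β) := by
  obtain ⟨D, hDe⟩ : ∃ D, D = β ^ 2 - β * l - l ^ 2 / 4 := ⟨_, rfl⟩
  rw [← hDe] at hD
  obtain ⟨τ, hτ⟩ : ∃ τ, τ = 2 * β - l := ⟨_, rfl⟩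
  obtain ⟨κ, hκ⟩ : ∃ κ, κ = 2 * γ * β * (β - l) - τ ^ 2 := ⟨_, rfl⟩
  obtain ⟨ν, hν, hνD, hνκ⟩ : ∃ ν > 0, 4 * ν ^ 2 ≤ D ∧ (0 < κ → 4 * ν ^ 2 ≤ κ) := by
    by_cases h : 0 < κ
    · have hm : 0 < min D κ := lt_min hD h
      refine ⟨√(min D κ) / 2, by positivity, ?_⟩
      rw [div_pow, Real.sq_sqrt hm.le]
      exact ⟨by linarith [min_le_left D κ], fun _ ↦ by linarith [min_le_right D κ]⟩
    · refine ⟨√D / 2, by positivity, ?_, fun h' ↦ absurd h' h⟩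
      rw [div_pow, Real.sq_sqrt hD.le]
      linarith
  obtain ⟨α, ξ, ζ, c, hc, hquad⟩ := exists_growing_quadratic hν hνκ
  obtain ⟨K, hK⟩ : ∃ K, K = β * (β - l) / (2 * c₀) := ⟨_, rfl⟩
  have hKc : 2 * c₀ * K = β * (β - l) := by rw [hK]; field_simp
  let π (i : Fin 7) : State →L[ℝ] ℝ := ContinuousLinearMap.proj i
  let m₁ := (1 / 2 : ℝ) • (π 3 - π 6)
  let m₂ := (1 / 2 : ℝ) • (π 4 + π 5)
  let g₁ := c₀ • (π 0 - π 2) + (τ / 2) • m₂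
  let g₂ := c₀ • π 1 - (τ / 2) • m₁
  let p := (1 / 2 : ℝ) • (π 3 + π 6)
  let s := (1 / 2 : ℝ) • (π 5 - π 4)
  let e := τ • s + c₀ • (π 0 + π 2)
  -- The factor scales the gain `c` of the `(p, e)` block to the weight needed to dominate the
  -- coupling with `s`.
  let η := (1 + τ ^ 2 / ν) / c
  let B := -functionalMul m₁ g₁ - functionalMul m₂ g₂ +
    η • (α • functionalMul p p + ξ • functionalMul e e + ζ • functionalMul p e) -
    functionalMul s s
  have hJ := hasFDerivAt_field_vortexState γ l c₀ β
  rw [← hK] at hJ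
  have hπ : ∀ i y, π i y = y i := fun _ _ ↦ rfl
  refine not_isLyapunovStable_of_quadraticForm (contDiff_field γ l 0 c₀)
    (isEquilibrium_vortexState γ l β hc₀) hJ B (ν := 2 * ν) (by positivity) (fun y hy ↦ ?_)
    -- Here `m₁ = 2c₀`, `g₁ = -2c₀` and the other block coordinates vanish, so `B v v = 4c₀²`.
    (v := ![-1, τ, 1, 2 * c₀, 0, 0, -(2 * c₀)]) ?_
  · obtain ⟨z, hz⟩ : ∃ z, z = jacobian γ l c₀ β K *ᵥ y := ⟨_, rfl⟩
    have hJy : (Matrix.toLin' (jacobian γ l c₀ β K)).toContinuousLinearMap y = z := by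
      rw [hz]; rfl
    rw [hJy]
    rw [jacobian_mulVec] at hz
    have hm₁ : m₁ z = -g₁ y + (β + l / 2) * m₂ y := by
      simp [m₁, m₂, g₁, hπ, hz, hτ]; ring
    have hm₂ : m₂ z = -g₂ y - (β + l / 2) * m₁ y := by
      simp [m₁, m₂, g₂, hπ, hz, hτ]; ring
    have hg₁ : g₁ z = (β + l / 2) * g₂ y - D * m₁ y := by
      simp [m₁, m₂, g₁, g₂, hπ, hz, hτ, hDe]
      linear_combination -(y 3 - y 6) * hKc
    have hg₂ : g₂ z = -(β + l / 2) * g₁ y - D * m₂ y := by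
      simp [m₁, m₂, g₁, g₂, hπ, hz, hτ, hDe]
      linear_combination -(y 4 + y 5) * hKc
    have hp : p z = -e y := by
      simp [p, e, s, hπ, hz, hτ]; ring
    have hs : s z = τ * p y := by
      simp [p, s, hπ, hz, hτ]; ring
    have he : e z = -(κ * p y) := by
      simp [p, s, e, hπ, hz, hτ, hκ]
      linear_combination -(γ * (y 3 + y 6)) * hKc
    have hB : ∀ u w, B u w = -(m₁ u * g₁ w) - m₂ u * g₂ w +
        η * (α * (p u * p w) + ξ * (e u * e w) + ζ * (p u * e w)) - s u * s w := fun u w ↦ by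
      simp [B, functionalMul_apply]; ring
    rw [hB, hB, hB, hm₁, hm₂, hg₁, hg₂, hp, hs, he]
    have hinj : ¬ (m₁ y = 0 ∧ m₂ y = 0 ∧ g₁ y = 0 ∧ g₂ y = 0 ∧ p y = 0 ∧ s y = 0 ∧ e y = 0) := by
      rintro ⟨h1, h2, h3, h4, h5, h6, h7⟩
      simp only [g₁, g₂, e, add_apply, sub_apply, smul_apply, smul_eq_mul, h1, h2, h6, mul_zero,
        add_zero, sub_zero, zero_add, mul_eq_zero, hc₀, false_or] at h3 h4 h7
      simp [m₁, m₂, p, s, hπ] at h1 h2 h3 h4 h5 h6 h7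
      refine hy (funext fun i ↦ ?_)
      fin_cases i <;> simp <;> linarith only [h1, h2, h3, h4, h5, h6, h7]
    have hX := hquad (p y) (e y)
    have hηc : η * c = 1 + τ ^ 2 / ν := by simp only [η]; field_simp
    have hη : 0 < η := by positivity
    have hηX := mul_le_mul_of_nonneg_left hX hη.le
    rw [← mul_assoc, hηc] at hηX
    generalize m₁ y = m₁, m₂ y = m₂, g₁ y = g₁, g₂ y = g₂, p y = p, s y = s, e y = e at *
    linarith only [growth_pos_of_ne_zero (τ := τ) hD hν hνD hinj, hηX]
  · simp [B, functionalMul_apply, m₁, m₂, g₁, g₂, p, s, e, hπ]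
    have : 0 < c₀ ^ 2 := by positivity
    nlinarith

end VortexODE

theorem mainTheorem3 (γ l c₀ : ℝ) (hγ : 1 < γ) (hl : 0 ≤ l) (hc₀ : 0 < c₀) :
    (∀ x : VortexODE.State,
      (VortexODE.IsEquilibrium (VortexODE.field γ l 0 c₀) x ∧ VortexODE.IsVortex x) ↔
        ∃ β : ℝ, β ≠ 0 ∧ x = VortexODE.vortexState l c₀ β) ∧
    (∀ x : VortexODE.State, VortexODE.IsEquilibrium (VortexODE.field γ l 0 c₀) x →
      (∃ β : ℝ, x = VortexODE.vortexState l c₀ β) ∨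
        (VortexODE.matQ x ^ 2 = 0 ∧ (VortexODE.matR x).det = 0)) ∧
    (∀ β : ℝ, (β < (1 - √2) / 2 * l ∨ (1 + √2) / 2 * l < β) →
      (∃ J : VortexODE.State →L[ℝ] VortexODE.State,
        HasFDerivAt (VortexODE.field γ l 0 c₀) J (VortexODE.vortexState l c₀ β) ∧
        ∃ z : ℂ, 0 < z.re ∧ VortexODE.HasComplexEigenvalue J z) ∧
      ¬ VortexODE.IsLyapunovStable (VortexODE.field γ l 0 c₀)
          (VortexODE.vortexState l c₀ β)) := by
  have hγ₀ : 0 < γ := one_pos.trans hγ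
  refine ⟨VortexODE.isEquilibrium_and_isVortex_iff hγ₀ hc₀,
    fun x hx ↦ hx.eq_vortexState_or hγ₀ hc₀, fun β hβ ↦ ⟨?_, ?_⟩⟩
  · exact ⟨_, VortexODE.hasFDerivAt_field_vortexState γ l c₀ β,
      VortexODE.exists_hasComplexEigenvalue_jacobian γ l β hc₀.ne' (VortexODE.discr_pos hl hβ)⟩
  · exact VortexODE.not_isLyapunovStable_vortexState γ l β hc₀.ne' (VortexODE.discr_pos hl hβ)
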